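/- Let $D$ be an (unoriented) link diagram in the sphere $S^2$ with $n$ crossings, and let $k>0$. Suppose that $D$ is $k$-almost alternating: there is a set of $k$ crossings such that switching all of them makes $D$ alternating, and no set of fewer than $k$ crossings has this property. Fix such a set of $k$ crossings; its elements are called dealternators. Suppose that, with respect to this set, - $D$ is *dealternator connected*: each of the $2^k$ diagrams obtained from $D$ by smoothing every dealternator, in one of the two possible ways each, is connected; - $D$ is *dealternator reduced*: each of these $2^k$ diagrams is reduced, that is, has no nugatory crossing (a crossing $c$ such that some simple closed curve in $S^2$ meets the projection of the diagram only at $c$, passing through $c$ transversely). Let $\langle D\rangle\in\mathbb Z[A,A^{-1}]$ be the Kauffman bracket of $D$, that is, $$\langle D\rangle=\sum_s A^{a(s)-b(s)}\,(-A^{2}-A^{-2})^{|sD|-1},$$ where $s$ runs over all choices of a smoothing of type $A$ or $B$ at each crossing, $a(s)$ and $b(s)$ are the numbers of $A$- and $B$-smoothings in $s$, and $|sD|$ is the number of circles of the resulting smoothed diagram. Then $\langle D\rangle\neq 0$, and its span, the difference between its maximal and minimal degrees, satisfies $$\operatorname{span}(\langle D\rangle)\le 4(n-k-2).$$ -/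

import Mathlib

/-- The two smoothings of a crossing. -/
inductive Smoothing
  | A
  | B
  deriving DecidableEq

instance : Fintype Smoothing where
  elems := {Smoothing.A, Smoothing.B}
  complete t := by cases t <;> simp

/-- The edge-ends at the crossings: `(x, i)`, with `i : ZMod 4`, are the four edge-ends at the
crossing `x`, numbered counterclockwise around `x`. The same pair `(x, i)` also names the corner
at `x` that lies between the edge-ends `(x, i)` and `(x, i + 1)`. -/
abbrev Dart (X : Type*) := X × ZMod 4

/-- Let `edge` send each edge-end to the other end of its edge. Walking along the edge from the
end `(x, i)` to the other end `(y, j)`, one has on the left first the corner `(x, i)` of `x` and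
then the corner `(y, j - 1)` of `y`, so that these two lie in the same face. -/
def nextCorner {X : Type*} (edge : Dart X → Dart X) (c : Dart X) : Dart X :=
  ((edge c).1, (edge c).2 - 1)

/-- The number of faces of the 4-valent map given by `edge` (on each connected component
separately): corners are identified along the sides of the edges. -/
noncomputable def numFaces {X : Type*} (edge : Dart X → Dart X) : ℕ :=
  Nat.card (Quot fun c d : Dart X => d = nextCorner edge c)

/-- The number of connected components of the 4-valent graph given by `edge`. -/
noncomputable def numGraphComponents {X : Type*} (edge : Dart X → Dart X) : ℕ :=
  Nat.card (Quot fun c d : Dart X => c.1 = d.1 ∨ d = edge c)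

/-- An unoriented link diagram on the 2-sphere with set of crossings `X`, as a 4-valent graph
with a rotation system of genus zero, over/under information at every crossing, and a number of
components without crossings. The position of the connected components of the projection
relative to each other is not recorded: no notion below depends on it. -/
structure LinkDiagram (X : Type*) [Fintype X] where
  /-- the other end of the edge that starts at a given edge-end -/
  edge : Dart X → Dart X
  edge_edge : ∀ d, edge (edge d) = d
  edge_ne : ∀ d, edge d ≠ d
  /-- whether an edge-end belongs to the overcrossing strand -/
  isOver : Dart X → Bool
  isOver_add_one : ∀ x i, isOver (x, i + 1) = !isOver (x, i)
  /-- the number of simple closed curves without crossings -/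
  circles : ℕ
  /-- Euler's formula, with `card X` vertices and `2 * card X` edges:
  every connected component of the projection lies on a sphere. -/
  planar : (Fintype.card X : ℤ) - 2 * Fintype.card X + numFaces edge
    = 2 * numGraphComponents edge

namespace LinkDiagram

variable {X : Type*} [Fintype X]

/-- Every edge goes from an overpass to an underpass. -/
def IsAlternating (D : LinkDiagram X) : Prop :=
  ∀ d, D.isOver (D.edge d) = !D.isOver d

/-- The diagram in which the crossings in `S` are switched. -/
def switch [DecidableEq X] (D : LinkDiagram X) (S : Finset X) : LinkDiagram X where
  edge := D.edge
  edge_edge := D.edge_edge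
  edge_ne := D.edge_ne
  isOver d := if d.1 ∈ S then !D.isOver d else D.isOver d
  isOver_add_one x i := by
    by_cases h : x ∈ S <;> simp [h, D.isOver_add_one]
  circles := D.circles
  planar := D.planar

/-- The corners that are joined by a smoothing. The `A`-smoothing of a crossing joins the two
corners swept out when the overcrossing strand is turned counterclockwise, and the `B`-smoothing
joins the other two. -/
def Opens (D : LinkDiagram X) (t : Smoothing) (c : Dart X) : Prop :=
  match t with
  | Smoothing.A => D.isOver c = true
  | Smoothing.B => D.isOver c = false

/-- Adjacency of edge-ends in the projection of the diagram obtained from `D` by smoothing the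
crossings `x` with `s x = some t` in the way `t` and keeping those with `s x = none`. A smoothing
connects the two edge-ends that bound a corner which it does not open. -/
inductive StrandStep (D : LinkDiagram X) (s : X → Option Smoothing) : Dart X → Dart X → Prop
  | edge (d : Dart X) : StrandStep D s d (D.edge d)
  | crossing (x : X) (i j : ZMod 4) (h : s x = none) : StrandStep D s (x, i) (x, j)
  | arc (x : X) (i : ZMod 4) (t : Smoothing) (h : s x = some t) (ho : ¬ D.Opens t (x, i)) :
      StrandStep D s (x, i) (x, i + 1)

/-- The number of connected components of the projection of the diagram smoothed by `s`. -/
noncomputable def numComponents (D : LinkDiagram X) (s : X → Option Smoothing) : ℕ :=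
  D.circles + Nat.card (Quot (D.StrandStep s))

/-- Adjacency of corners in the diagram smoothed by `s`: corners are adjacent along the sides of
the edges, and opposite corners of a smoothed crossing are adjacent if the smoothing joins them. -/
inductive RegionStep (D : LinkDiagram X) (s : X → Option Smoothing) : Dart X → Dart X → Prop
  | side (c : Dart X) : RegionStep D s c (nextCorner D.edge c)
  | channel (x : X) (i : ZMod 4) (t : Smoothing) (h : s x = some t) (ho : D.Opens t (x, i)) :
      RegionStep D s (x, i) (x, i + 2)

/-- The regions of the complement of the diagram smoothed by `s`. -/
def Region (D : LinkDiagram X) (s : X → Option Smoothing) : Type _ := Quot (D.RegionStep s)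

/-- The region that contains a given corner. -/
def region (D : LinkDiagram X) (s : X → Option Smoothing) (c : Dart X) : D.Region s :=
  Quot.mk _ c

/-- The diagram smoothed by `s` is connected. -/
def SmoothedConnected (D : LinkDiagram X) (s : X → Option Smoothing) : Prop :=
  D.numComponents s = 1

/-- The diagram smoothed by `s` is reduced: it has no nugatory crossing, that is, no remaining
crossing with two opposite corners in the same region (equivalently, no simple closed curve meets
the projection in this crossing only, passing through it between opposite corners). -/
def SmoothedReduced (D : LinkDiagram X) (s : X → Option Smoothing) : Prop :=
  ∀ x, s x = none → ∀ i : ZMod 4, D.region s (x, i) ≠ D.region s (x, i + 2)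

/-- `S` is a set of `k` dealternators of `D`: switching the crossings in `S` makes `D`
alternating, and this cannot be achieved by switching fewer than `k` crossings. -/
structure IsDealternatorSet [DecidableEq X] (D : LinkDiagram X) (k : ℕ) (S : Finset X) :
    Prop where
  card_eq : S.card = k
  alternating : (D.switch S).IsAlternating
  minimal : ∀ T : Finset X, (D.switch T).IsAlternating → k ≤ T.card

/-- Smooth the crossings in `S` according to `t` and keep the other ones. -/
def smoothOn [DecidableEq X] (S : Finset X) (t : X → Smoothing) : X → Option Smoothing :=
  fun x => if x ∈ S then some (t x) else none

/-- All the diagrams obtained by smoothing every crossing in `S` are connected. -/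
def DealternatorConnected [DecidableEq X] (D : LinkDiagram X) (S : Finset X) : Prop :=
  ∀ t : X → Smoothing, D.SmoothedConnected (smoothOn S t)

/-- All the diagrams obtained by smoothing every crossing in `S` are reduced. -/
def DealternatorReduced [DecidableEq X] (D : LinkDiagram X) (S : Finset X) : Prop :=
  ∀ t : X → Smoothing, D.SmoothedReduced (smoothOn S t)

/-- The number of circles of a state. -/
noncomputable def numCircles (D : LinkDiagram X) (s : X → Smoothing) : ℕ :=
  D.numComponents fun x => some (s x)

/-- The exponent with which a smoothing contributes to the Kauffman bracket. -/
def smoothingExponent : Smoothing → ℤ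
  | Smoothing.A => 1
  | Smoothing.B => -1

open LaurentPolynomial in
/-- The Kauffman bracket of a (nonempty) diagram, as a Laurent polynomial in the variable `A`,
with value `1` on the diagram of the unknot without crossings:
the sum over all states `s` of `A ^ (a(s) - b(s)) * (-A ^ 2 - A ^ (-2)) ^ (|s D| - 1)`. -/
noncomputable def bracket [DecidableEq X] (D : LinkDiagram X) : LaurentPolynomial ℤ :=
  ∑ s : X → Smoothing, T (∑ x, smoothingExponent (s x)) *
    (-T 2 - T (-2)) ^ (D.numCircles s - 1)

end LinkDiagram

/-- The span of a nonzero Laurent polynomial: its maximal degree minus its minimal degree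
(and `0` for the zero polynomial). -/
noncomputable def laurentSpan (p : LaurentPolynomial ℤ) : ℤ :=
  if h : p.coeff.support.Nonempty then p.coeff.support.max' h - p.coeff.support.min' h else 0

/-!
Expand the bracket along the dealternators: `k` crossings `S`, each smoothed in one of two ways.
The top degree (in `A`) of the part belonging to a smoothing `t` of `S` is reached by the state
that smooths the crossings outside `S` by `A`. All other states have a top degree that is lower by
at least `4`: since the smoothed diagram is reduced and alternating, each circle of that state lies
in one region (`region_colouredCorner_eq`), so the first change of a smoothing outside `S` merges
two circles (`numCircles_add_two_le`), and no later change can raise the degree.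

The point is that these `2 ^ k` top degrees coincide. Let `w` be the number of circles of the state
that smooths the crossings outside `S` by `A` and those in `S` by `B`; as switching `S` makes `D`
alternating, its circles bound the faces of one checkerboard colour. Each smoothing in `S` that is
changed to `A` costs exactly one circle (`numCircles_extend_add`), which offsets the change of the
exponent. It costs at most one, and the two colours together have `n + 2` faces by Euler's formula
(`numFaces_le`, `card_add_two_le_numFaces`), while connectedness of the smoothed diagram, which has
`n - k` crossings, bounds the number of circles for both colours by `n - k + 2`
(`numCircles_getD_add_le`). So equality holds throughout. The top coefficient belonging to `t` is
a fixed sign times `(-1) ^ a`, where `a` is the number of `A`-smoothings in `t`, and these signs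
cancel as `k > 0`. Hence the degree is at most `n - 2 * k + 2 * w - 6`
(`bracket_mem_signedDegreeLE`). The same holds at the other end with `B` in place of `A`, and the
two values of `w` add up to `n + 2`, which gives the bound on the span.

Everything about circles rests on two facts about a single crossing: smoothing it adds at most
one component, and at least one of its two smoothings adds none (`numComponents_update_eq`). The
second one is a parity argument: a strand that leaves a crossing must come back to it.

The bracket is nonzero because at `A = 1` modulo `3` each of the `2 ^ n` states contributes `1`
(`bracket_ne_zero`).
-/

namespace Smoothing

/-- The other smoothing of the same crossing. -/
def opp : Smoothing → Smoothing
  | A => B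
  | B => A

@[simp]
theorem opp_opp (t : Smoothing) : t.opp.opp = t := by cases t <;> rfl

theorem opp_ne (t : Smoothing) : t.opp ≠ t := by cases t <;> simp [opp]

theorem ne_iff_eq_opp {t u : Smoothing} : t ≠ u ↔ t = u.opp := by
  cases t <;> cases u <;> simp [opp]

end Smoothing

/-! ### Counting classes of generated equivalence relations -/

section QuotCard

variable {V : Type*} {r r' : V → V → Prop}

theorem card_quot_le_of_le [Finite V] (h : ∀ a b, r a b → Quot.mk r' a = Quot.mk r' b) :
    Nat.card (Quot r') ≤ Nat.card (Quot r) :=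
  Nat.card_le_card_of_surjective (Quot.lift (Quot.mk r') h) fun q =>
    Quot.inductionOn q fun a => ⟨Quot.mk r a, rfl⟩

theorem card_quot_lt_of_le [Finite V] (h : ∀ a b, r a b → Quot.mk r' a = Quot.mk r' b)
    {a b : V} (hab : Quot.mk r a ≠ Quot.mk r b) (hab' : Quot.mk r' a = Quot.mk r' b) :
    Nat.card (Quot r') < Nat.card (Quot r) := by
  refine lt_of_le_of_ne (card_quot_le_of_le h) fun hcard => hab ?_
  have hsurj : Function.Surjective (Quot.lift (Quot.mk r') h) := fun q =>
    Quot.inductionOn q fun a => ⟨Quot.mk r a, rfl⟩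
  exact ((Nat.bijective_iff_surjective_and_card _).2 ⟨hsurj, hcard.symm⟩).1 hab'

/-- Identifying two classes lowers the number of classes by at most one. -/
theorem card_quot_le_add_one [Finite V] (P Q : Quot r)
    (h : ∀ a b, r' a b → Quot.mk r a = Quot.mk r b ∨
      ((Quot.mk r a = P ∨ Quot.mk r a = Q) ∧ (Quot.mk r b = P ∨ Quot.mk r b = Q))) :
    Nat.card (Quot r) ≤ Nat.card (Quot r') + 1 := by
  classical
  let g : Quot r' → Quot r := Quot.lift
    (fun a => if Quot.mk r a = P then Q else Quot.mk r a) (by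
      intro a b hab
      rcases h a b hab with h | ⟨h1, h2⟩
      · rw [h]
      · split_ifs <;> simp_all)
  have hs : Function.Surjective (fun o : Option (Quot r') => o.elim P g) := by
    intro q
    by_cases hq : q = P
    · exact ⟨none, hq.symm⟩
    · induction q using Quot.inductionOn with
      | h a => exact ⟨some (Quot.mk r' a), if_neg hq⟩
  have := Nat.card_le_card_of_surjective _ hs
  rwa [Finite.card_option] at this

end QuotCard

namespace LinkDiagram

variable {X : Type*} [Fintype X]

theorem opens_add_one (D : LinkDiagram X) (t : Smoothing) (x : X) (i : ZMod 4) :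
    D.Opens t (x, i + 1) ↔ ¬ D.Opens t (x, i) := by
  cases t <;> simp [Opens, D.isOver_add_one]

theorem opens_sub_one (D : LinkDiagram X) (t : Smoothing) (x : X) (i : ZMod 4) :
    D.Opens t (x, i - 1) ↔ ¬ D.Opens t (x, i) := by
  have := D.opens_add_one t x (i - 1)
  rw [sub_add_cancel] at this
  tauto

theorem opens_add_two (D : LinkDiagram X) (t : Smoothing) (x : X) (i : ZMod 4) :
    D.Opens t (x, i + 2) ↔ D.Opens t (x, i) := by
  rw [show i + 2 = i + 1 + 1 by ring, opens_add_one, opens_add_one, not_not]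

theorem opens_opp (D : LinkDiagram X) (t : Smoothing) (c : Dart X) :
    D.Opens t.opp c ↔ ¬ D.Opens t c := by
  cases t <;> simp [Opens, Smoothing.opp]

theorem exists_not_opens (D : LinkDiagram X) (t : Smoothing) (x : X) :
    ∃ i, ¬ D.Opens t (x, i) := by
  by_cases h : D.Opens t (x, 0)
  · exact ⟨0 + 1, by rwa [opens_add_one, not_not]⟩
  · exact ⟨0, h⟩

theorem opens_edge {D : LinkDiagram X} (hD : D.IsAlternating) (t : Smoothing) (d : Dart X) :
    D.Opens t (D.edge d) ↔ ¬ D.Opens t d := by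
  cases t <;> simp [Opens, hD d]

/-! ### Changing the smoothing of one crossing -/

theorem zmod_four_cases (i j : ZMod 4) : j = i ∨ j = i + 1 ∨ j = i + 2 ∨ j = i + 3 := by
  revert i j; decide

section Parity

open Classical in
/-- The other end of the arc of the smoothing `t` that starts at a given edge-end. -/
noncomputable def arcEnd (D : LinkDiagram X) (t : Smoothing) (d : Dart X) : Dart X :=
  if D.Opens t d then (d.1, d.2 - 1) else (d.1, d.2 + 1)

theorem arcEnd_fst (D : LinkDiagram X) (t : Smoothing) (d : Dart X) :
    (D.arcEnd t d).1 = d.1 := by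
  unfold arcEnd; split_ifs <;> rfl

theorem arcEnd_ne (D : LinkDiagram X) (t : Smoothing) (d : Dart X) : D.arcEnd t d ≠ d := by
  obtain ⟨x, i⟩ := d
  unfold arcEnd
  split_ifs <;> simp <;> decide

theorem arcEnd_arcEnd (D : LinkDiagram X) (t : Smoothing) (d : Dart X) :
    D.arcEnd t (D.arcEnd t d) = d := by
  obtain ⟨x, i⟩ := d
  by_cases h : D.Opens t (x, i)
  · have h' : ¬ D.Opens t (x, i - 1) := by rwa [opens_sub_one, not_not]
    simp [arcEnd, h, h']
  · have h' : D.Opens t (x, i + 1) := by rwa [opens_add_one]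
    simp [arcEnd, h, h']

theorem even_card_of_involution {V : Type*} (C : Finset V) (f : V → V)
    (hf : ∀ a ∈ C, f a ∈ C) (hne : ∀ a, f a ≠ a) (hinv : ∀ a, f (f a) = a) : Even C.card := by
  have h : (∑ _a ∈ C, (1 : ZMod 2)) = 0 :=
    Finset.sum_involution (fun a _ => f a) (fun _ _ => by decide) (fun a _ _ => hne a)
      (fun a ha => hf a ha) (fun a _ => hinv a)
  rw [Finset.sum_const, nsmul_one] at h
  exact (ZMod.natCast_eq_zero_iff_even).1 h

/-- If all crossings but `x` are smoothed, then the strand that leaves `x` through a given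
edge-end comes back to `x` through another one: every class of edge-ends meets the edge-ends at
`x` in an even number of elements. -/
theorem exists_strand_return (D : LinkDiagram X) (t : X → Smoothing) (x : X) (i : ZMod 4) :
    ∃ j ≠ i, Quot.mk (fun c d => d = D.edge c ∨ c.1 ≠ x ∧ d = D.arcEnd (t c.1) c) (x, j)
      = Quot.mk _ (x, i) := by
  classical
  set R : Dart X → Dart X → Prop :=
    fun c d => d = D.edge c ∨ c.1 ≠ x ∧ d = D.arcEnd (t c.1) c
  by_contra! hcon
  let C : Finset (Dart X) := {d | Quot.mk R d = Quot.mk R (x, i)}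
  have hC : Even C.card := by
    refine even_card_of_involution C D.edge (fun a ha => ?_) D.edge_ne D.edge_edge
    simp only [C, Finset.mem_filter, Finset.mem_univ, true_and] at ha ⊢
    rw [← ha]
    exact (Quot.sound (show R a (D.edge a) from Or.inl rfl)).symm
  have hE : Even (C.erase (x, i)).card := by
    refine even_card_of_involution _ (fun d => D.arcEnd (t d.1) d) (fun a ha => ?_)
      (fun a => D.arcEnd_ne _ _) (fun a => by rw [D.arcEnd_fst, D.arcEnd_arcEnd])
    simp only [C, Finset.mem_erase, Finset.mem_filter, Finset.mem_univ, true_and] at ha ⊢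
    have hax : a.1 ≠ x := by
      intro h
      obtain ⟨y, j⟩ := a
      dsimp only at h
      subst h
      exact hcon j (fun h => ha.1 (by rw [h])) ha.2
    refine ⟨fun h => hax (by simpa [D.arcEnd_fst] using congrArg Prod.fst h), ?_⟩
    rw [← ha.2]
    exact (Quot.sound (show R a (D.arcEnd (t a.1) a) from Or.inr ⟨hax, rfl⟩)).symm
  have hmem : (x, i) ∈ C := by simp [C]
  have := Finset.card_erase_add_one hmem
  rw [← this] at hC
  exact (Nat.even_add_one.1 hC) hE

end Parity

theorem strand_arc {D : LinkDiagram X} {p : X → Option Smoothing} {x : X} {i : ZMod 4}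
    {t : Smoothing} (h : p x = some t) (ho : ¬ D.Opens t (x, i)) :
    Quot.mk (D.StrandStep p) (x, i) = Quot.mk _ (x, i + 1) :=
  Quot.sound (StrandStep.arc x i t h ho)

theorem strand_arc' {D : LinkDiagram X} {p : X → Option Smoothing} {x : X} {i : ZMod 4}
    {t : Smoothing} (h : p x = some t) (ho : ¬ D.Opens t (x, i)) :
    Quot.mk (D.StrandStep p) (x, i + 2) = Quot.mk _ (x, i + 3) := by
  have := strand_arc h (i := i + 2) (by rwa [D.opens_add_two])
  rwa [add_assoc, show (2 : ZMod 4) + 1 = 3 from rfl] at this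

theorem strand_arcEnd (D : LinkDiagram X) {p : X → Option Smoothing} (d : Dart X)
    {t : Smoothing} (h : p d.1 = none ∨ p d.1 = some t) :
    Quot.mk (D.StrandStep p) d = Quot.mk _ (D.arcEnd t d) := by
  obtain ⟨x, i⟩ := d
  unfold arcEnd
  rcases h with h | h
  · split_ifs <;> exact Quot.sound (StrandStep.crossing _ _ _ h)
  · split_ifs with ho
    · have := strand_arc h (i := i - 1) (by rwa [D.opens_sub_one, not_not])
      rw [sub_add_cancel] at this
      exact this.symm
    · exact strand_arc h ho

variable [DecidableEq X]

/-- Steps at the other crossings do not depend on how `x` is treated, so only the steps that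
stay at `x` matter when two treatments of `x` are compared. -/
theorem strandStep_update {D : LinkDiagram X} {p : X → Option Smoothing} {x : X}
    {o o' : Option Smoothing} {c d : Dart X}
    (h : D.StrandStep (Function.update p x o) c d) :
    D.StrandStep (Function.update p x o') c d ∨
      (c.1 = x ∧ d.1 = x ∧ D.StrandStep (Function.update p x o) c d) := by
  have h0 := h
  cases h with
  | edge => exact Or.inl (StrandStep.edge _)
  | crossing y i j h =>
    by_cases hy : y = x
    · exact Or.inr ⟨hy, hy, h0⟩
    · exact Or.inl (StrandStep.crossing y i j (by simpa [hy] using h))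
  | arc y i t h ho =>
    by_cases hy : y = x
    · exact Or.inr ⟨hy, hy, h0⟩
    · exact Or.inl (StrandStep.arc y i t (by simpa [hy] using h) ho)

theorem strand_update_none (D : LinkDiagram X) (p : X → Option Smoothing) (x : X)
    (o : Option Smoothing) (c d : Dart X) (h : D.StrandStep (Function.update p x o) c d) :
    Quot.mk (D.StrandStep (Function.update p x none)) c = Quot.mk _ d := by
  rcases strandStep_update (o' := none) h with h | ⟨hc, hd, -⟩
  · exact Quot.sound h
  · obtain ⟨y, i⟩ := c
    obtain ⟨z, j⟩ := d
    dsimp only at hc hd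
    subst hc hd
    exact Quot.sound (StrandStep.crossing _ _ _ (by simp))

theorem numComponents_update_none_le (D : LinkDiagram X) (p : X → Option Smoothing) (x : X)
    (o : Option Smoothing) :
    D.numComponents (Function.update p x none) ≤ D.numComponents (Function.update p x o) :=
  Nat.add_le_add_left (card_quot_le_of_le (D.strand_update_none p x o)) _

theorem numComponents_update_le_add_one (D : LinkDiagram X) (p : X → Option Smoothing) (x : X)
    (t : Smoothing) :
    D.numComponents (Function.update p x (some t)) ≤
      D.numComponents (Function.update p x none) + 1 := by
  unfold numComponents
  rw [add_assoc]
  refine Nat.add_le_add_left ?_ _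
  obtain ⟨i, hi⟩ := D.exists_not_opens t x
  have hp : Function.update p x (some t) x = some t := by simp
  have key : ∀ c : Dart X, c.1 = x →
      Quot.mk (D.StrandStep (Function.update p x (some t))) c = Quot.mk _ (x, i) ∨
      Quot.mk (D.StrandStep (Function.update p x (some t))) c = Quot.mk _ (x, i + 2) := by
    rintro ⟨y, j⟩ hy
    dsimp only at hy
    subst hy
    rcases zmod_four_cases i j with rfl | rfl | rfl | rfl
    · exact Or.inl rfl
    · exact Or.inl (strand_arc hp hi).symm
    · exact Or.inr rfl
    · exact Or.inr (strand_arc' hp hi).symm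
  refine card_quot_le_add_one (Quot.mk _ (x, i)) (Quot.mk _ (x, i + 2)) fun c d h => ?_
  rcases strandStep_update (o' := some t) h with h | ⟨hc, hd, -⟩
  · exact Or.inl (Quot.sound h)
  · exact Or.inr ⟨key c hc, key d hd⟩

/-- At least one of the two smoothings of a crossing does not disconnect anything. -/
theorem numComponents_update_eq (D : LinkDiagram X) (p : X → Option Smoothing) (x : X)
    (t : Smoothing) :
    D.numComponents (Function.update p x (some t)) = D.numComponents (Function.update p x none) ∨
    D.numComponents (Function.update p x (some t.opp)) =
      D.numComponents (Function.update p x none) := by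
  obtain ⟨i, hi⟩ := D.exists_not_opens t x
  obtain ⟨j, hji, hj⟩ := D.exists_strand_return (fun y => (p y).getD Smoothing.A) x i
  have lift : ∀ u : Smoothing,
      Quot.mk (D.StrandStep (Function.update p x (some u))) (x, j) = Quot.mk _ (x, i) := by
    intro u
    have hmap : ∀ c d : Dart X,
        (d = D.edge c ∨ c.1 ≠ x ∧ d = D.arcEnd ((p c.1).getD Smoothing.A) c) →
        Quot.mk (D.StrandStep (Function.update p x (some u))) c = Quot.mk _ d := by
      rintro c d (rfl | ⟨hc, rfl⟩)
      · exact Quot.sound (StrandStep.edge c)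
      · refine D.strand_arcEnd c ?_
        rw [Function.update_of_ne hc]
        cases p c.1 <;> simp
    exact congrArg (Quot.lift _ hmap) hj
  have glue : ∀ u : Smoothing,
      (∀ l, Quot.mk (D.StrandStep (Function.update p x (some u))) (x, l) = Quot.mk _ (x, i)) →
      D.numComponents (Function.update p x (some u)) =
        D.numComponents (Function.update p x none) := by
    intro u hu
    refine le_antisymm (Nat.add_le_add_left (card_quot_le_of_le fun c d h => ?_) _)
      (D.numComponents_update_none_le p x _)
    rcases strandStep_update (o' := some u) h with h | ⟨hc, hd, -⟩
    · exact Quot.sound h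
    · obtain ⟨y, a⟩ := c
      obtain ⟨z, b⟩ := d
      dsimp only at hc hd
      subst hc hd
      rw [hu a, hu b]
  have h1 := strand_arc (D := D) (p := Function.update p x (some t)) (by simp) hi
  have h2 := strand_arc' (D := D) (p := Function.update p x (some t)) (by simp) hi
  have hi' : ¬ D.Opens t.opp (x, i + 1) := by
    rw [D.opens_opp, D.opens_add_one, not_not]; exact hi
  have h3 := strand_arc (D := D) (p := Function.update p x (some t.opp)) (by simp) hi'
  have h4 := strand_arc' (D := D) (p := Function.update p x (some t.opp)) (by simp) hi'
  rw [show i + 1 + 1 = i + 2 by ring] at h3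
  rw [show i + 1 + 2 = i + 3 by ring, add_assoc, show (1 : ZMod 4) + 3 = 0 from rfl,
    add_zero] at h4
  have l1 := lift t
  have l2 := lift t.opp
  rcases zmod_four_cases i j with rfl | rfl | rfl | rfl
  · exact absurd rfl hji
  · right
    refine glue _ fun l => ?_
    rcases zmod_four_cases i l with rfl | rfl | rfl | rfl
    · rfl
    · exact l2
    · rw [← h3, l2]
    · exact h4
  · left
    refine glue _ fun l => ?_
    rcases zmod_four_cases i l with rfl | rfl | rfl | rfl
    · rfl
    · exact h1.symm
    · exact l1
    · rw [← h2, l1]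
  · left
    refine glue _ fun l => ?_
    rcases zmod_four_cases i l with rfl | rfl | rfl | rfl
    · rfl
    · exact h1.symm
    · rw [h2, l1]
    · exact l1

end LinkDiagram

namespace LinkDiagram

variable {X : Type*} [Fintype X]

/-! ### Circles of states -/

theorem numCircles_pos [Nonempty X] (D : LinkDiagram X) (s : X → Smoothing) :
    0 < D.numCircles s := by
  have : Nonempty (Quot (D.StrandStep fun x => some (s x))) :=
    ⟨Quot.mk _ (Classical.arbitrary X, 0)⟩
  exact Nat.add_pos_right _ Nat.card_pos

theorem card_add_two_le_numFaces [Nonempty X] (D : LinkDiagram X) :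
    Fintype.card X + 2 ≤ numFaces D.edge := by
  have : Nonempty (Quot fun c d : Dart X => c.1 = d.1 ∨ d = D.edge c) :=
    ⟨Quot.mk _ (Classical.arbitrary X, 0)⟩
  have hpos : 0 < numGraphComponents D.edge := Nat.card_pos
  have := D.planar
  omega

variable [DecidableEq X]

theorem numCircles_le_update (D : LinkDiagram X) (s : X → Smoothing) (x : X) (t : Smoothing) :
    D.numCircles s ≤ D.numCircles (Function.update s x t) + 1 := by
  have h1 := D.numComponents_update_le_add_one (fun y => some (s y)) x (s x)
  have h2 := D.numComponents_update_none_le (fun y => some (s y)) x (some t)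
  rw [← Function.comp_def some s, ← Function.comp_update] at h1 h2
  rw [Function.update_eq_self] at h1
  exact h1.trans (Nat.add_le_add_right h2 1)

theorem numCircles_le_add_card (D : LinkDiagram X) (s s' : X → Smoothing) :
    D.numCircles s ≤ D.numCircles s' + ({x | s x ≠ s' x} : Finset X).card := by
  have key : ∀ F : Finset X, D.numCircles s ≤ D.numCircles (F.piecewise s' s) + F.card := by
    intro F
    induction F using Finset.induction_on with
    | empty => simp
    | insert x F hx ih =>
      rw [Finset.piecewise_insert, Finset.card_insert_of_notMem hx]
      have := D.numCircles_le_update (F.piecewise s' s) x (s' x)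
      omega
  convert key {x | s x ≠ s' x} using 3
  ext x
  by_cases h : s x = s' x <;> simp [Finset.piecewise, h]

/-- The dual state inequality: it expresses that the genus of the surface spanned by a partially
smoothed diagram is nonnegative. -/
theorem numCircles_getD_add_le (D : LinkDiagram X) (u : Smoothing) (p : X → Option Smoothing) :
    D.numCircles (fun x => (p x).getD u) + D.numCircles (fun x => (p x).getD u.opp) ≤
      ({x | p x = none} : Finset X).card + 2 * D.numComponents p := by
  induction hm : ({x | p x = none} : Finset X).card generalizing p with
  | zero =>
    have hp : ∀ x, p x ≠ none := by simpa [Finset.filter_eq_empty_iff] using hm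
    have hfill : ∀ v, (fun x => some ((p x).getD v)) = p := by
      intro v
      ext1 x
      cases h : p x with
      | none => exact absurd h (hp x)
      | some t => rfl
    simp only [numCircles, hfill]
    omega
  | succ m ih =>
    obtain ⟨x, hx⟩ : ({x | p x = none} : Finset X).Nonempty := by
      rw [← Finset.card_pos]; omega
    have hx' : p x = none := by simpa using hx
    -- a smoothing of `x` that does not disconnect the diagram
    obtain ⟨t, ht⟩ : ∃ t, D.numComponents (Function.update p x (some t)) = D.numComponents p := by
      have h := D.numComponents_update_eq p x Smoothing.A
      rw [show Function.update p x none = p by rw [← hx', Function.update_eq_self]] at h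
      rcases h with h | h <;> exact ⟨_, h⟩
    have hcard : ({y | Function.update p x (some t) y = none} : Finset X).card = m := by
      rw [← Nat.add_right_cancel_iff (n := 1), ← hm, ← Finset.card_erase_add_one hx]
      congr 2
      ext y
      by_cases hy : y = x <;> simp [hy, Function.update_apply]
    have hfill : ∀ v, (fun y => (Function.update p x (some t) y).getD v) =
        Function.update (fun y => (p y).getD v) x t := by
      intro v
      ext1 y
      by_cases hy : y = x
      · subst hy; simp
      · simp [hy]
    have hself : ∀ v, v = t → Function.update (fun y => (p y).getD v) x t =
        fun y => (p y).getD v := by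
      rintro v rfl
      rw [Function.update_eq_self_iff]
      simp [hx']
    have h := ih _ hcard
    rw [ht, hfill, hfill] at h
    have h1 := D.numCircles_le_update (fun y => (p y).getD u) x t
    have h2 := D.numCircles_le_update (fun y => (p y).getD u.opp) x t
    by_cases htu : t = u
    · rw [hself u htu.symm] at h
      omega
    · rw [hself u.opp (Smoothing.ne_iff_eq_opp.1 htu).symm] at h
      omega

/-- If the two arcs at a crossing lie on different circles of a state, then changing the
smoothing there merges these circles. -/
theorem numCircles_update_opp_lt (D : LinkDiagram X) (s : X → Smoothing) (x : X) (i : ZMod 4)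
    (h : Quot.mk (D.StrandStep fun y => some (s y)) (x, i) ≠ Quot.mk _ (x, i + 2)) :
    D.numCircles (Function.update s x (s x).opp) < D.numCircles s := by
  have heq : (fun y => some (s y)) = Function.update (fun y => some (s y)) x (some (s x)) := by
    simp
  have hlt : D.numComponents (Function.update (fun y => some (s y)) x none) <
      D.numCircles s := by
    refine Nat.add_lt_add_left (card_quot_lt_of_le (fun c d hcd => ?_) h
      (Quot.sound (StrandStep.crossing x i (i + 2) (by simp)))) _
    rw [heq] at hcd
    exact D.strand_update_none _ x _ c d hcd
  have hor := D.numComponents_update_eq (fun y => some (s y)) x (s x)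
  rw [← heq] at hor
  rcases hor with hor | hor
  · exact absurd hor.symm hlt.ne
  · rw [← hor] at hlt
    rwa [← Function.comp_def some s, ← Function.comp_update] at hlt

/-! ### Checkerboard colouring -/

theorem opens_switch (D : LinkDiagram X) (S : Finset X) (u : Smoothing) (d : Dart X) :
    (D.switch S).Opens u d ↔ if d.1 ∈ S then ¬ D.Opens u d else D.Opens u d := by
  by_cases h : d.1 ∈ S <;> cases u <;> simp [Opens, switch, h]

/-- Let the crossings in `S` be smoothed according to `t`, and the other ones by `u`. -/
def extend (S : Finset X) (u : Smoothing) (t : X → Smoothing) : X → Smoothing :=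
  fun x => if x ∈ S then t x else u

open Classical in
/-- If switching the crossings in `S` makes `D` alternating, then the corners that are not opened
by `u` after this switch form one of the two colour classes of the checkerboard colouring of the
faces. This is the corner of that colour next to a given edge-end. -/
noncomputable def colouredCorner (D : LinkDiagram X) (S : Finset X) (u : Smoothing)
    (d : Dart X) : Dart X :=
  if (D.switch S).Opens u d then (d.1, d.2 - 1) else d

theorem quot_colouredCorner_edge (D : LinkDiagram X) {S : Finset X}
    (hS : (D.switch S).IsAlternating) (u : Smoothing) {r : Dart X → Dart X → Prop}
    (hr : ∀ c, r c (nextCorner D.edge c)) (d : Dart X) :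
    Quot.mk r (D.colouredCorner S u d) = Quot.mk r (D.colouredCorner S u (D.edge d)) := by
  have h : (D.switch S).Opens u (D.edge d) ↔ ¬ (D.switch S).Opens u d := opens_edge hS u d
  by_cases hd : (D.switch S).Opens u d
  · have := Quot.sound (hr (D.edge d))
    rw [nextCorner, D.edge_edge] at this
    simpa [colouredCorner, h, hd] using this.symm
  · simpa [colouredCorner, h, hd, nextCorner] using Quot.sound (hr d)

theorem colouredCorner_add_one (D : LinkDiagram X) {S : Finset X} {u : Smoothing} {x : X}
    {i : ZMod 4} (h : ¬ (D.switch S).Opens u (x, i)) :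
    D.colouredCorner S u (x, i) = D.colouredCorner S u (x, i + 1) := by
  have h' : (D.switch S).Opens u (x, i + 1) := by rwa [opens_add_one]
  simp [colouredCorner, h, h']

/-- If the crossings outside `S` are smoothed by `u` and those in `S` by `u.opp`, then each circle
of the state follows the boundary of a face of the colour given by `u`. -/
theorem quot_colouredCorner_eq_of_face (D : LinkDiagram X) {S : Finset X}
    (hS : (D.switch S).IsAlternating) (u : Smoothing) (c d : Dart X)
    (h : D.StrandStep (fun x => some (extend S u (fun _ => u.opp) x)) c d) :
    Quot.mk (fun c d => d = nextCorner D.edge c) (D.colouredCorner S u c) =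
      Quot.mk _ (D.colouredCorner S u d) := by
  cases h with
  | edge =>
    exact D.quot_colouredCorner_edge hS u (r := fun c d => d = nextCorner D.edge c)
      (fun _ => rfl) c
  | crossing x i j h => cases h
  | arc x i t h ho =>
    rw [D.colouredCorner_add_one]
    rw [opens_switch]
    obtain rfl := Option.some.inj h
    by_cases hx : x ∈ S
    · simpa [extend, hx, opens_opp] using ho
    · simpa [extend, hx] using ho

/-- Each circle of the state that smooths the crossings outside `S` by `u` stays in one region
of the diagram in which only the crossings in `S` are smoothed. -/
theorem region_colouredCorner_eq (D : LinkDiagram X) {S : Finset X}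
    (hS : (D.switch S).IsAlternating) (u : Smoothing) (t : X → Smoothing) (c d : Dart X)
    (h : D.StrandStep (fun x => some (extend S u t x)) c d) :
    D.region (smoothOn S t) (D.colouredCorner S u c) =
      D.region (smoothOn S t) (D.colouredCorner S u d) := by
  cases h with
  | edge => exact D.quot_colouredCorner_edge hS u RegionStep.side c
  | crossing x i j h => cases h
  | arc x i v h ho =>
    obtain rfl := Option.some.inj h
    by_cases hx : x ∈ S
    · by_cases hu : t x = u
      · -- the arc crosses the faces of the other colour, and the smoothing joins the two
        -- coloured corners at its ends
        have hi : (D.switch S).Opens u (x, i) := by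
          rw [opens_switch]
          simpa [extend, hx, hu] using ho
        have hi' : ¬ (D.switch S).Opens u (x, i + 1) := by rwa [opens_add_one, not_not]
        have hstep : D.RegionStep (smoothOn S t) (x, i - 1) (x, i - 1 + 2) :=
          RegionStep.channel x (i - 1) (t x) (by simp [smoothOn, hx])
            (by rw [opens_sub_one]; simpa [extend, hx] using ho)
        rw [show i - 1 + 2 = i + 1 by ring] at hstep
        have hreg : D.region (smoothOn S t) (x, i - 1) = D.region (smoothOn S t) (x, i + 1) :=
          Quot.sound hstep
        simpa [colouredCorner, hi, hi'] using hreg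
      · rw [D.colouredCorner_add_one]
        rw [opens_switch]
        rw [← ne_eq, Smoothing.ne_iff_eq_opp] at hu
        simpa [extend, hx, hu, opens_opp] using ho
    · rw [D.colouredCorner_add_one]
      rw [opens_switch]
      simpa [extend, hx] using ho

theorem numFaces_le (D : LinkDiagram X) {S : Finset X} (hS : (D.switch S).IsAlternating)
    (u : Smoothing) :
    numFaces D.edge ≤ D.numCircles (extend S u fun _ => u.opp) +
      D.numCircles (extend S u.opp fun _ => u.opp.opp) := by
  let f (v : Smoothing) := Quot.lift _ (D.quot_colouredCorner_eq_of_face hS v)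
  have hsurj : Function.Surjective (Sum.elim (f u) (f u.opp)) := by
    intro q
    induction q using Quot.inductionOn with
    | h c =>
      by_cases hc : (D.switch S).Opens u c
      · have hc' : ¬ (D.switch S).Opens u.opp c := by rwa [opens_opp, not_not]
        exact ⟨Sum.inr (Quot.mk _ c), by simp [f, colouredCorner, hc']⟩
      · exact ⟨Sum.inl (Quot.mk _ c), by simp [f, colouredCorner, hc]⟩
  have := Nat.card_le_card_of_surjective _ hsurj
  rw [Nat.card_sum] at this
  exact this.trans (add_le_add (Nat.le_add_left _ _) (Nat.le_add_left _ _))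

/-! ### States that smooth the other crossings in the same way -/

theorem numCircles_extend_aux [Nonempty X] (D : LinkDiagram X) {S : Finset X}
    (hS : (D.switch S).IsAlternating) (hconn : D.DealternatorConnected S) (u : Smoothing)
    (t : X → Smoothing) :
    D.numCircles (extend S u t) + (S.filter fun x => t x = u).card =
        D.numCircles (extend S u fun _ => u.opp) ∧
      D.numCircles (extend S u fun _ => u.opp) +
        D.numCircles (extend S u.opp fun _ => u.opp.opp) = Fintype.card X + 2 := by
  have hfill : ∀ v, (fun x => ((smoothOn S t) x).getD v) = extend S v t := by
    intro v
    ext1 x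
    by_cases hx : x ∈ S <;> simp [smoothOn, extend, hx]
  have hdual := D.numCircles_getD_add_le u (smoothOn S t)
  rw [hfill, hfill, hconn t] at hdual
  have hnone : ({x | smoothOn S t x = none} : Finset X) = Sᶜ := by
    ext x
    simp [smoothOn]
  rw [hnone, Finset.card_compl] at hdual
  have hcard := S.card_le_univ
  have hlip : ∀ v, D.numCircles (extend S v fun _ => v.opp) ≤
      D.numCircles (extend S v t) + (S.filter fun x => t x = v).card := by
    intro v
    refine (D.numCircles_le_add_card _ (extend S v t)).trans_eq ?_
    congr 2
    ext x
    by_cases hx : x ∈ S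
    · have : v.opp ≠ t x ↔ t x = v := by
        rw [ne_comm, Smoothing.ne_iff_eq_opp, Smoothing.opp_opp]
      simpa [extend, hx] using this
    · simp [extend, hx]
  have h1 := hlip u
  have h2 := hlip u.opp
  have hsum := S.card_filter_add_card_filter_not (fun x => t x = u)
  simp only [← ne_eq, Smoothing.ne_iff_eq_opp] at hsum
  have hf := (D.card_add_two_le_numFaces).trans (D.numFaces_le hS u)
  omega

/-- Let the smoothing of dealternators be `t`, and let all other crossings be smoothed by `u`.
Every dealternator that is smoothed by `u` as well costs one circle. -/
theorem numCircles_extend_add [Nonempty X] (D : LinkDiagram X) {S : Finset X}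
    (hS : (D.switch S).IsAlternating) (hconn : D.DealternatorConnected S) (u : Smoothing)
    (t : X → Smoothing) :
    D.numCircles (extend S u t) + (S.filter fun x => t x = u).card =
      D.numCircles (extend S u fun _ => u.opp) :=
  (D.numCircles_extend_aux hS hconn u t).1

theorem numCircles_extend_opp_add [Nonempty X] (D : LinkDiagram X) {S : Finset X}
    (hS : (D.switch S).IsAlternating) (hconn : D.DealternatorConnected S) (u : Smoothing) :
    D.numCircles (extend S u fun _ => u.opp) +
        D.numCircles (extend S u.opp fun _ => u.opp.opp) = Fintype.card X + 2 :=
  (D.numCircles_extend_aux hS hconn u fun _ => u).2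

/-- Adequacy: changing the smoothing of a crossing outside `S` merges two circles. -/
theorem numCircles_update_extend_lt (D : LinkDiagram X) {S : Finset X}
    (hS : (D.switch S).IsAlternating) (hred : D.DealternatorReduced S) (u : Smoothing)
    (t : X → Smoothing) {x : X} (hx : x ∉ S) :
    D.numCircles (Function.update (extend S u t) x u.opp) < D.numCircles (extend S u t) := by
  obtain ⟨i, hi⟩ := (D.switch S).exists_not_opens u x
  have hi' : ¬ (D.switch S).Opens u (x, i + 2) := by rwa [opens_add_two]
  have hxu : extend S u t x = u := by simp [extend, hx]
  have := D.numCircles_update_opp_lt (extend S u t) x i fun h => by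
    refine hred t x (by simp [smoothOn, hx]) i ?_
    simpa [colouredCorner, hi, hi'] using
      congrArg (Quot.lift _ (D.region_colouredCorner_eq hS u t)) h
  rwa [hxu] at this

/-- A state `s` that disagrees with `u` somewhere outside `S` has at least two circles fewer than
`numCircles_le_add_card` allows in comparison with the state that agrees with `u` there. -/
theorem numCircles_add_two_le (D : LinkDiagram X) {S : Finset X}
    (hS : (D.switch S).IsAlternating) (hred : D.DealternatorReduced S) (u : Smoothing)
    (s : X → Smoothing) {x : X} (hx : x ∉ S) (hsx : s x ≠ u) :
    D.numCircles s + 2 ≤ D.numCircles (extend S u s) +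
      (Sᶜ.filter fun y => s y ≠ u).card := by
  have h1 := D.numCircles_update_extend_lt hS hred u s hx
  have h2 := D.numCircles_le_add_card s (Function.update (extend S u s) x u.opp)
  have h3 : ({y | s y ≠ Function.update (extend S u s) x u.opp y} : Finset X) =
      (Sᶜ.filter fun y => s y ≠ u).erase x := by
    ext y
    by_cases hy : y = x
    · subst hy
      simpa using Smoothing.ne_iff_eq_opp.1 hsx
    · by_cases hyS : y ∈ S <;> simp [hy, extend, hyS]
  have h4 : x ∈ Sᶜ.filter fun y => s y ≠ u := by simp [hx, hsx]
  rw [h3] at h2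
  have := Finset.card_erase_add_one h4
  omega

end LinkDiagram

/-! ### Laurent polynomials of bounded degree -/

section Degree

open LaurentPolynomial

/-- The Laurent polynomials whose exponents `j` satisfy `ε * j ≤ d`. For `ε = 1` this bounds the
degree from above, and for `ε = -1` it bounds the lowest exponent from below. -/
def signedDegreeLE (ε d : ℤ) : AddSubgroup (LaurentPolynomial ℤ) where
  carrier := {p | ∀ j, d < ε * j → p.coeff j = 0}
  zero_mem' := by simp
  add_mem' := by
    intro p q hp hq j hj
    simp [hp j hj, hq j hj]
  neg_mem' := by
    intro p hp j hj
    simp [hp j hj]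

theorem signedDegreeLE_mono {ε d d' : ℤ} (h : d ≤ d') {p : LaurentPolynomial ℤ}
    (hp : p ∈ signedDegreeLE ε d) : p ∈ signedDegreeLE ε d' :=
  fun j hj => hp j (h.trans_lt hj)

theorem T_mem_signedDegreeLE {ε d n : ℤ} (h : ε * n ≤ d) :
    (T n : LaurentPolynomial ℤ) ∈ signedDegreeLE ε d := by
  intro j hj
  rw [T_apply, if_neg]
  rintro rfl
  omega

/-- The extreme terms of a power of the loop value `-A² - A⁻²`; the exponents in it differ by
multiples of `4`. -/
theorem T_mul_pow_sub_mem {ε : ℤ} (hε : ε * ε = 1) (m : ℕ) (e : ℤ) :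
    T e * (-T 2 - T (-2)) ^ m - ((-1) ^ m : ℤ) • T (e + ε * (2 * m)) ∈
      signedDegreeLE ε (ε * e + 2 * m - 4) := by
  induction m generalizing e with
  | zero => simp
  | succ m ih =>
    have h1 := ih (e + 2 * ε)
    have h2 := ih (e - 2 * ε)
    have h3 : T (e - 2 * ε) * (-T 2 - T (-2)) ^ m ∈ signedDegreeLE ε (ε * e + 2 * m - 2) := by
      have hT : ((-1) ^ m : ℤ) • (T (e - 2 * ε + ε * (2 * m)) : LaurentPolynomial ℤ) ∈
          signedDegreeLE ε (ε * e + 2 * m - 2) := by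
        refine AddSubgroup.zsmul_mem _ (T_mem_signedDegreeLE (le_of_eq ?_)) _
        linear_combination (2 * (m : ℤ) - 2) * hε
      rw [← sub_add_cancel (T (e - 2 * ε) * (-T 2 - T (-2)) ^ m)
        (((-1) ^ m : ℤ) • T (e - 2 * ε + ε * (2 * m)))]
      refine add_mem (signedDegreeLE_mono ?_ h2) hT
      linarith [mul_sub ε e (2 * ε)]
    have h1' : ε * (e + 2 * ε) + 2 * m - 4 = ε * e + 2 * ((m + 1 : ℕ) : ℤ) - 4 := by
      push_cast
      linear_combination 2 * hε
    rw [h1'] at h1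
    have h3' := signedDegreeLE_mono
      (show ε * e + 2 * (m : ℤ) - 2 ≤ ε * e + 2 * ((m + 1 : ℕ) : ℤ) - 4 by push_cast; linarith) h3
    have hexp : (e + 2 * ε + ε * (2 * m) : ℤ) = e + ε * (2 * ((m + 1 : ℕ) : ℤ)) := by
      push_cast
      ring
    rw [hexp] at h1
    convert sub_mem (neg_mem h1) h3' using 1
    have hT : T e * (-T 2 - T (-2)) = -T (e + 2 * ε) - (T (e - 2 * ε) : LaurentPolynomial ℤ) := by
      rcases mul_self_eq_one_iff.1 hε with rfl | rfl
      · rw [mul_sub, mul_neg, ← T_add, ← T_add, mul_one, sub_eq_add_neg e 2]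
      · rw [mul_sub, mul_neg, ← T_add, ← T_add, mul_neg_one, sub_neg_eq_add]
        abel
    rw [pow_succ', ← mul_assoc, hT, pow_succ]
    simp only [sub_mul, neg_mul, mul_neg, mul_one, neg_smul]
    abel

theorem T_mul_pow_mem {ε : ℤ} (hε : ε * ε = 1) (m : ℕ) (e : ℤ) :
    T e * (-T 2 - T (-2)) ^ m ∈ signedDegreeLE ε (ε * e + 2 * m) := by
  rw [← sub_add_cancel (T e * (-T 2 - T (-2)) ^ m) (((-1) ^ m : ℤ) • T (e + ε * (2 * m)))]
  refine add_mem (signedDegreeLE_mono (by linarith) (T_mul_pow_sub_mem hε m e))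
    (AddSubgroup.zsmul_mem _ (T_mem_signedDegreeLE (le_of_eq ?_)) _)
  linear_combination 2 * (m : ℤ) * hε

theorem laurentSpan_le {p : LaurentPolynomial ℤ} (hp : p ≠ 0) {d d' : ℤ}
    (h : p ∈ signedDegreeLE 1 d) (h' : p ∈ signedDegreeLE (-1) d') :
    laurentSpan p ≤ d + d' := by
  have hne : p.coeff.support.Nonempty := by
    rw [Finsupp.support_nonempty_iff]
    exact fun h0 => hp (LaurentPolynomial.ext fun a => by simp [h0])
  have h1 : p.coeff.support.max' hne ≤ d := by
    by_contra! hlt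
    exact Finsupp.mem_support_iff.1 (Finset.max'_mem _ hne) (h _ (by linarith))
  have h2 : -d' ≤ p.coeff.support.min' hne := by
    by_contra! hlt
    exact Finsupp.mem_support_iff.1 (Finset.min'_mem _ hne) (h' _ (by linarith))
  rw [laurentSpan, dif_pos hne]
  linarith

end Degree

namespace LinkDiagram

variable {X : Type*} [Fintype X]

/-! ### The bracket -/

theorem smoothingExponent_mul_self (u : Smoothing) :
    smoothingExponent u * smoothingExponent u = 1 := by
  cases u <;> rfl

theorem smoothingExponent_mul_sum (u : Smoothing) (s : X → Smoothing) :
    smoothingExponent u * ∑ x, smoothingExponent (s x) =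
      Fintype.card X - 2 * (({x | s x ≠ u} : Finset X).card : ℤ) := by
  have h : ∀ x, smoothingExponent u * smoothingExponent (s x) =
      1 - 2 * if s x ≠ u then 1 else 0 := by
    intro x
    cases u <;> cases s x <;> simp [smoothingExponent]
  rw [Finset.mul_sum, Finset.sum_congr rfl fun x _ => h x, Finset.sum_sub_distrib,
    ← Finset.mul_sum, Finset.sum_boole]
  simp

open LaurentPolynomial

variable [DecidableEq X]

/-- The bracket does not vanish: at `A = 1` and modulo `3` every state contributes `1`, since the
value `-2` of a circle becomes `1`. -/
theorem bracket_ne_zero (D : LinkDiagram X) : D.bracket ≠ 0 := by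
  intro h
  have h1 := congrArg (eval₂ (Int.castRingHom (ZMod 3)) (1 : (ZMod 3)ˣ)) h
  have h2 : (-1 - 1 : ZMod 3) = 1 := by decide
  simp only [bracket, map_sum, map_mul, map_pow, map_sub, map_neg, eval₂_T, one_zpow,
    Units.val_one, h2, one_pow, mul_one, map_zero, Finset.sum_const, nsmul_one,
    Finset.card_univ, Fintype.card_fun] at h1
  have h3 : Fintype.card Smoothing = 2 := rfl
  rw [h3, Nat.cast_pow] at h1
  exact pow_ne_zero _ (by decide : ((2 : ℕ) : ZMod 3) ≠ 0) h1

/-- Flipping the smoothing of one crossing in `S` reverses the sign, so the signs cancel. -/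
theorem sum_neg_one_pow_card_eq_zero {M : Type*} [AddCommGroup M] {S : Finset X}
    (hS : S.Nonempty) (u : Smoothing) (m : M) :
    ∑ s : X → Smoothing, (if ∀ x ∉ S, s x = u then
      ((-1) ^ (S.filter fun x => s x = u).card : ℤ) • m else 0) = 0 := by
  obtain ⟨x₀, hx₀⟩ := hS
  have hsign : ∀ s : X → Smoothing, ((-1) ^ (S.filter fun x => s x = u).card : ℤ) =
      (if s x₀ = u then -1 else 1) * ∏ x ∈ S.erase x₀, if s x = u then -1 else 1 := by
    intro s
    rw [Finset.mul_prod_erase S (fun x => if s x = u then (-1 : ℤ) else 1) hx₀,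
      Finset.prod_ite]
    simp
  refine Finset.sum_involution (fun s _ => Function.update s x₀ (s x₀).opp) ?_ ?_ ?_ ?_
  · intro s _
    have hiff : (∀ x ∉ S, Function.update s x₀ (s x₀).opp x = u) ↔ ∀ x ∉ S, s x = u := by
      refine forall₂_congr fun x hx => ?_
      rw [Function.update_of_ne (by rintro rfl; exact hx hx₀)]
    simp only [hiff]
    split_ifs with h
    · rw [hsign, hsign (Function.update s x₀ (s x₀).opp), ← add_smul]
      have hprod : (∏ x ∈ S.erase x₀,
          if Function.update s x₀ (s x₀).opp x = u then (-1 : ℤ) else 1) =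
          ∏ x ∈ S.erase x₀, if s x = u then (-1 : ℤ) else 1 := by
        refine Finset.prod_congr rfl fun x hx => ?_
        rw [Function.update_of_ne (Finset.ne_of_mem_erase hx)]
      rw [hprod, ← add_mul, Function.update_self]
      cases u <;> cases s x₀ <;> simp [Smoothing.opp]
    · simp
  · intro s _ _ h
    have := congrFun h x₀
    rw [Function.update_self] at this
    exact Smoothing.opp_ne _ this
  · simp
  · simp

/-- The bound for one end of the bracket. If the crossings outside `S` are smoothed by `u`, then
the extreme exponent of the contribution of the state does not depend on the smoothing on `S`, and
the extreme coefficients cancel. -/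
theorem bracket_mem_signedDegreeLE [Nonempty X] (D : LinkDiagram X) {S : Finset X}
    (hne : S.Nonempty) (hS : (D.switch S).IsAlternating) (hconn : D.DealternatorConnected S)
    (hred : D.DealternatorReduced S) (u : Smoothing) :
    D.bracket ∈ signedDegreeLE (smoothingExponent u)
      (2 * D.numCircles (extend S u fun _ => u.opp) + Fintype.card X - 2 * S.card - 6) := by
  set w := D.numCircles (extend S u fun _ => u.opp) with hw
  set ε := smoothingExponent u with hεdef
  have hε : ε * ε = 1 := smoothingExponent_mul_self u
  have hlead := sum_neg_one_pow_card_eq_zero hne u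
    (((-1) ^ (w + 1) : ℤ) •
      (T (ε * (2 * w + Fintype.card X - 2 * S.card - 2)) : LaurentPolynomial ℤ))
  rw [← sub_zero D.bracket, ← hlead, bracket, ← Finset.sum_sub_distrib]
  refine sum_mem fun s _ => ?_
  have hexp := smoothingExponent_mul_sum u s
  rw [← hεdef] at hexp
  set e := ∑ x, smoothingExponent (s x) with he
  have hpos := D.numCircles_pos s
  have hext := D.numCircles_extend_add hS hconn u s
  rw [← hw] at hext
  have hsum := S.card_filter_add_card_filter_not (fun x => s x = u)
  have hsplit : ({x | s x ≠ u} : Finset X).card =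
      (S.filter fun x => s x ≠ u).card + (Sᶜ.filter fun x => s x ≠ u).card := by
    rw [← Finset.card_union_of_disjoint, ← Finset.filter_union, Finset.union_compl]
    exact Finset.disjoint_filter_filter disjoint_compl_right
  simp only [← ne_eq] at hsum
  split_ifs with h
  · have hs : extend S u s = s := by
      ext1 x
      by_cases hx : x ∈ S
      · simp [extend, hx]
      · simp [extend, hx, h x hx]
    rw [hs] at hext
    have hzero : (Sᶜ.filter fun x => s x ≠ u).card = 0 := by
      simpa [Finset.filter_eq_empty_iff] using h
    have hval : ε * e + 2 * ((D.numCircles s - 1 : ℕ) : ℤ) =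
        2 * w + Fintype.card X - 2 * S.card - 2 := by
      omega
    have hT : ε * (2 * w + Fintype.card X - 2 * S.card - 2) =
        e + ε * (2 * ((D.numCircles s - 1 : ℕ) : ℤ)) := by
      rw [← hval]
      linear_combination e * hε
    have hsign : ((-1) ^ (S.filter fun x => s x = u).card * (-1) ^ (w + 1) : ℤ) =
        (-1) ^ (D.numCircles s - 1) := by
      rw [← pow_add, show (S.filter fun x => s x = u).card + (w + 1) = (D.numCircles s - 1) +
        2 * ((S.filter fun x => s x = u).card + 1) by omega, pow_add, pow_mul]
      simp
    rw [smul_smul, hsign, hT]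
    exact signedDegreeLE_mono (by omega) (T_mul_pow_sub_mem hε _ e)
  · push Not at h
    obtain ⟨x, hx, hsx⟩ := h
    have hadd := D.numCircles_add_two_le hS hred u s hx hsx
    rw [sub_zero]
    exact signedDegreeLE_mono (by omega) (T_mul_pow_mem hε _ e)

end LinkDiagram

theorem mainTheorem4 {X : Type*} [Fintype X] [DecidableEq X] (D : LinkDiagram X)
    (k : ℕ) (hk : 0 < k) (S : Finset X) (hS : D.IsDealternatorSet k S)
    (hconn : D.DealternatorConnected S) (hred : D.DealternatorReduced S) :
    D.bracket ≠ 0 ∧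
      laurentSpan D.bracket ≤ 4 * ((Fintype.card X : ℤ) - (k : ℤ) - 2) := by
  have hne : S.Nonempty := by
    rw [← Finset.card_pos, hS.card_eq]
    exact hk
  have : Nonempty X := hne.to_type
  refine ⟨D.bracket_ne_zero, ?_⟩
  have hA := D.bracket_mem_signedDegreeLE hne hS.alternating hconn hred Smoothing.A
  have hB := D.bracket_mem_signedDegreeLE hne hS.alternating hconn hred Smoothing.B
  have hsum := D.numCircles_extend_opp_add hS.alternating hconn Smoothing.A
  have hspan := laurentSpan_le D.bracket_ne_zero hA hB
  have hcard := hS.card_eq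
  simp only [Smoothing.opp] at hsum hspan
  omega
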